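/- Consider partial multi-valued functions $P :\subseteq \mathbb{N}^{\mathbb{N}} \rightrightarrows \mathbb{N}^{\mathbb{N}}$ on Baire space. A choice function of $P$ is a partial function $f$ with $\operatorname{dom}(f) \supseteq \operatorname{dom}(P)$ and $f(x) \in P(x)$ for all $x \in \operatorname{dom}(P)$. Let $P \leq_W Q$ (Weihrauch reducibility) mean that there are computable partial functions $H, K :\subseteq \mathbb{N}^{\mathbb{N}} \to \mathbb{N}^{\mathbb{N}}$ such that, for every choice function $g$ of $Q$, the function $x \mapsto H\langle x, g(K(x))\rangle$ is a choice function of $P$. Let $\mathfrak{W}$ be the partially ordered set of equivalence classes of this preorder (the Weihrauch degrees), together with an artificial top element $\top$. It is a bounded lattice, with least element the degree of the multi-valued function with empty domain. The supremum of the degrees of $P$ and $Q$ is the degree of the coproduct $P \coprod Q$, given by $(P \coprod Q)(0p) = 0P(p)$ and $(P \coprod Q)(1p) = 1Q(p)$; their infimum is the degree of $P \oplus Q$, given by $(P \oplus Q)(\langle p, q\rangle) = 0P(p) \cup 1Q(q)$ for $p \in \operatorname{dom}(P)$, $q \in \operatorname{dom}(Q)$. Let $p\mathfrak{W}$ be the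 sublattice of pointed degrees, i.e. of all degrees in $\mathfrak{W}$ above or equal to the degree of the identity $\mathrm{id}_{\mathbb{N}^{\mathbb{N}}}$. A bounded lattice $\mathfrak{L}$ is a Brouwer algebra if for all $\mathbf{a}, \mathbf{b} \in \mathfrak{L}$ the set $\{\mathbf{c} \in \mathfrak{L} \mid \mathbf{b} \leq \mathbf{c} \vee \mathbf{a}\}$ contains a smallest element. Theorem. Neither $\mathfrak{W}$ nor $p\mathfrak{W}$ is a Brouwer algebra. -/

import Mathlib

/-! # Weihrauch degrees

Oracle computations on Baire space, Weihrauch reducibility, the lattice `𝔚` of Weihrauch degrees,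
the lattice `p𝔚` of pointed Weihrauch degrees, and Brouwer algebras. -/

namespace Weihrauch

/-! ## Baire space and computable functions on it -/

/-- Baire space `ℕ^ℕ`. -/
abbrev Baire : Type := ℕ → ℕ

/-- The sequence `k p`: first entry `k`, followed by the entries of `p`. -/
def cons (k : ℕ) (p : Baire) : Baire
  | 0 => k
  | n + 1 => p n

/-- The shift: drops the first entry of a sequence. -/
def shift (p : Baire) : Baire := fun n => p (n + 1)

/-- The standard pairing `⟨p, q⟩ = p(0) q(0) p(1) q(1) …` of Baire space. -/
def pair (p q : Baire) : Baire := fun n => if n % 2 = 0 then p (n / 2) else q (n / 2)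

/-- First projection of the pairing. -/
def left (p : Baire) : Baire := fun n => p (2 * n)

/-- Second projection of the pairing. -/
def right (p : Baire) : Baire := fun n => p (2 * n + 1)

/-- Programs for oracle computations: the schemes of partial recursive functions (as in
`Nat.Partrec`) together with a call to the oracle. -/
inductive OracleCode : Type
  | zero : OracleCode
  | succ : OracleCode
  | left : OracleCode
  | right : OracleCode
  | oracle : OracleCode
  | pair : OracleCode → OracleCode → OracleCode
  | comp : OracleCode → OracleCode → OracleCode
  | prec : OracleCode → OracleCode → OracleCode
  | rfind : OracleCode → OracleCode

/-- The partial function `ℕ → ℕ` that a program computes with oracle `p`. -/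
def OracleCode.eval (p : Baire) : OracleCode → ℕ → Part ℕ
  | .zero => fun _ => Part.some 0
  | .succ => fun n => Part.some (n + 1)
  | .left => fun n => Part.some n.unpair.1
  | .right => fun n => Part.some n.unpair.2
  | .oracle => fun n => Part.some (p n)
  | .pair f g => fun n => (eval p f n).bind fun a => (eval p g n).map (Nat.pair a)
  | .comp f g => fun n => (eval p g n).bind (eval p f)
  | .prec f g => fun m =>
      m.unpair.2.rec (eval p f m.unpair.1) fun y IH =>
        IH.bind fun i => eval p g (Nat.pair m.unpair.1 (Nat.pair y i))
  | .rfind f => fun a => Nat.rfind fun n => (eval p f (Nat.pair a n)).map fun m => decide (m = 0)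

/-- The program `c` with oracle `p` computes (the entries of) the sequence `q`. -/
def Computes (c : OracleCode) (p q : Baire) : Prop := ∀ n, q n ∈ c.eval p n

/-- A partial function `F :⊆ ℕ^ℕ → ℕ^ℕ` is computable if a single program computes `F(p)` from the
oracle `p`, for all `p ∈ dom F`. -/
def ComputableFun (F : Baire →. Baire) : Prop :=
  ∃ c : OracleCode, ∀ p q, q ∈ F p → Computes c p q

/-! ## Multi-valued functions and Weihrauch reducibility -/

/-- A partial multi-valued function `P :⊆ ℕ^ℕ ⇉ ℕ^ℕ`; the set `P.val x` of values is empty exactly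
if `x` is not in the domain. -/
@[ext] structure Problem : Type where
  val : Baire → Set Baire

namespace Problem

/-- The domain of a partial multi-valued function. -/
def dom (P : Problem) : Set Baire := {x | (P.val x).Nonempty}

/-- The partial function `f` is a choice function of `P`: it is defined at least on `dom P`, and
`f(x) ∈ P(x)` for all `x ∈ dom P`. -/
def IsChoice (P : Problem) (f : Baire →. Baire) : Prop :=
  ∀ x ∈ P.dom, ∃ y ∈ f x, y ∈ P.val x

/-- Weihrauch reducibility: there are computable `H, K :⊆ ℕ^ℕ → ℕ^ℕ` such that for all choice
functions `g` of `Q`, the function `x ↦ H⟨x, g(K(x))⟩` is a choice function of `P`. -/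
def Reducible (P Q : Problem) : Prop :=
  ∃ H K : Baire →. Baire, ComputableFun H ∧ ComputableFun K ∧
    ∀ g : Baire →. Baire, Q.IsChoice g →
      P.IsChoice fun x => (K x).bind fun u => (g u).bind fun v => H (pair x v)

/-- The identity on Baire space. -/
def ident : Problem := ⟨fun x => {x}⟩

/-- The multi-valued function with empty domain. -/
def empty : Problem := ⟨fun _ => ∅⟩

/-- The coproduct `P ∐ Q`: `(P ∐ Q)(0p) = 0P(p)` and `(P ∐ Q)(1p) = 1Q(p)`. -/
def coprod (P Q : Problem) : Problem :=
  ⟨fun x => {y | (∃ p, ∃ r ∈ P.val p, x = cons 0 p ∧ y = cons 0 r) ∨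
    (∃ p, ∃ r ∈ Q.val p, x = cons 1 p ∧ y = cons 1 r)}⟩

/-- The sum `P ⊕ Q`: `(P ⊕ Q)(⟨p, q⟩) = 0P(p) ∪ 1Q(q)` for `p ∈ dom P` and `q ∈ dom Q`. -/
def oplus (P Q : Problem) : Problem :=
  ⟨fun x => {y | ∃ p ∈ P.dom, ∃ q ∈ Q.dom, x = pair p q ∧
    ((∃ r ∈ P.val p, y = cons 0 r) ∨ (∃ r ∈ Q.val q, y = cons 1 r))}⟩

end Problem

/-! ## Closure properties of oracle programs -/

@[simp] theorem left_pair (p q : Baire) : left (pair p q) = p := by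
  funext n; simp [left, pair]

@[simp] theorem right_pair (p q : Baire) : right (pair p q) = q := by
  funext n
  have h1 : (2 * n + 1) % 2 = 1 := by omega
  have h2 : (2 * n + 1) / 2 = n := by omega
  simp [right, pair, h1, h2]

@[simp] theorem shift_cons (k : ℕ) (p : Baire) : shift (cons k p) = p := rfl

@[simp] theorem cons_zero (k : ℕ) (p : Baire) : cons k p 0 = k := rfl

theorem cons_inj {k l : ℕ} {p q : Baire} (h : cons k p = cons l q) : k = l ∧ p = q :=
  ⟨congrFun h 0, congrArg shift h⟩

theorem pair_inj {p q p' q' : Baire} (h : pair p q = pair p' q') : p = p' ∧ q = q' :=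
  ⟨by simpa using congrArg left h, by simpa using congrArg right h⟩

theorem Computes.unique {c : OracleCode} {p q r : Baire} (hq : Computes c p q)
    (hr : Computes c p r) : q = r :=
  funext fun n => Part.mem_unique (hq n) (hr n)

/-- Every partial recursive function is computed by a program that ignores its oracle. -/
theorem exists_code_of_partrec {f : ℕ →. ℕ} (hf : Nat.Partrec f) :
    ∃ c : OracleCode, ∀ p, c.eval p = f := by
  induction hf with
  | zero => exact ⟨.zero, fun _ => rfl⟩
  | succ => exact ⟨.succ, fun _ => rfl⟩
  | left => exact ⟨.left, fun _ => rfl⟩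
  | right => exact ⟨.right, fun _ => rfl⟩
  | pair _ _ ih₁ ih₂ =>
    obtain ⟨c, hc⟩ := ih₁
    obtain ⟨d, hd⟩ := ih₂
    exact ⟨.pair c d, fun p => by simp only [OracleCode.eval, hc p, hd p]; rfl⟩
  | comp _ _ ih₁ ih₂ =>
    obtain ⟨c, hc⟩ := ih₁
    obtain ⟨d, hd⟩ := ih₂
    exact ⟨.comp c d, fun p => by simp only [OracleCode.eval, hc p, hd p]; rfl⟩
  | prec _ _ ih₁ ih₂ =>
    obtain ⟨c, hc⟩ := ih₁
    obtain ⟨d, hd⟩ := ih₂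
    exact ⟨.prec c d, fun p => by simp only [OracleCode.eval, hc p, hd p]; rfl⟩
  | rfind _ ih =>
    obtain ⟨c, hc⟩ := ih
    exact ⟨.rfind c, fun p => by simp only [OracleCode.eval, hc p]; rfl⟩

theorem exists_code_of_computable {f : ℕ → ℕ} (hf : Computable f) :
    ∃ c : OracleCode, ∀ p n, c.eval p n = Part.some (f n) := by
  obtain ⟨c, hc⟩ := exists_code_of_partrec (Partrec.nat_iff.1 hf)
  exact ⟨c, fun p n => by rw [hc p]; rfl⟩

/-- Replace the oracle of a program by a program. -/
def OracleCode.subst (d : OracleCode) : OracleCode → OracleCode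
  | .zero => .zero
  | .succ => .succ
  | .left => .left
  | .right => .right
  | .oracle => d
  | .pair f g => .pair (subst d f) (subst d g)
  | .comp f g => .comp (subst d f) (subst d g)
  | .prec f g => .prec (subst d f) (subst d g)
  | .rfind f => .rfind (subst d f)

theorem OracleCode.eval_subst {d : OracleCode} {p q : Baire} (h : Computes d p q)
    (c : OracleCode) : (subst d c).eval p = c.eval q := by
  induction c with
  | oracle => exact funext fun n => Part.eq_some_iff.2 (h n)
  | zero | succ | left | right => rfl
  | pair f g ih₁ ih₂ | comp f g ih₁ ih₂ | prec f g ih₁ ih₂ =>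
    simp only [subst, eval, ih₁, ih₂]
  | rfind f ih => simp only [subst, eval, ih]

theorem Computes.trans {c d : OracleCode} {p q r : Baire} (hd : Computes d p q)
    (hc : Computes c q r) : Computes (OracleCode.subst d c) p r := by
  intro n; rw [OracleCode.eval_subst hd]; exact hc n

theorem computes_oracle (p : Baire) : Computes .oracle p p := fun _ => Part.mem_some _

/-- Reading off the entries of the oracle along a computable sequence of positions. -/
theorem exists_code_reindex {f : ℕ → ℕ} (hf : Computable f) :
    ∃ c, ∀ p, Computes c p (fun n => p (f n)) := by
  obtain ⟨c, hc⟩ := exists_code_of_computable hf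
  refine ⟨.comp .oracle c, fun p n => ?_⟩
  simp [OracleCode.eval, hc]

theorem exists_code_left : ∃ c, ∀ p, Computes c p (left p) :=
  exists_code_reindex (Primrec.nat_mul.comp (.const 2) .id).to_comp

theorem exists_code_right : ∃ c, ∀ p, Computes c p (right p) :=
  exists_code_reindex (Primrec.succ.comp (Primrec.nat_mul.comp (.const 2) .id)).to_comp

theorem exists_code_shift : ∃ c, ∀ p, Computes c p (shift p) :=
  exists_code_reindex Computable.succ

theorem exists_code_pair (c d : OracleCode) :
    ∃ e, ∀ p q r, Computes c p q → Computes d p r → Computes e p (pair q r) := by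
  have h2 : Computable (fun n : ℕ => n / 2) :=
    (Primrec.nat_div.comp .id (.const 2)).to_comp
  have h : Computable (fun n : ℕ =>
      if n.unpair.1 % 2 = 0 then n.unpair.2.unpair.1 else n.unpair.2.unpair.2) :=
    (Primrec.ite (Primrec.eq.comp (Primrec.nat_mod.comp (Primrec.fst.comp .unpair) (.const 2))
      (.const 0)) (Primrec.fst.comp (Primrec.unpair.comp (Primrec.snd.comp .unpair)))
      (Primrec.snd.comp (Primrec.unpair.comp (Primrec.snd.comp .unpair)))).to_comp
  obtain ⟨a, ha⟩ := exists_code_of_computable h2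
  obtain ⟨b, hb⟩ := exists_code_of_computable h
  obtain ⟨i, hi⟩ := exists_code_of_computable Computable.id
  refine ⟨.comp b (.pair i (.pair (.comp c a) (.comp d a))), fun p q r hq hr n => ?_⟩
  have h1 := Part.eq_some_iff.2 (hq (n / 2))
  have h3 := Part.eq_some_iff.2 (hr (n / 2))
  simp [OracleCode.eval, ha, hb, hi, h1, h3, pair]

theorem exists_code_cons (k : ℕ) (c : OracleCode) :
    ∃ e, ∀ p q, Computes c p q → Computes e p (cons k q) := by
  have h1 : Computable (fun n : ℕ => n - 1) := Primrec.pred.to_comp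
  have h : Computable (fun n : ℕ => if n.unpair.1 = 0 then k else n.unpair.2) :=
    (Primrec.ite (Primrec.eq.comp (Primrec.fst.comp .unpair) (.const 0)) (.const k)
      (Primrec.snd.comp .unpair)).to_comp
  obtain ⟨a, ha⟩ := exists_code_of_computable h1
  obtain ⟨b, hb⟩ := exists_code_of_computable h
  obtain ⟨i, hi⟩ := exists_code_of_computable Computable.id
  refine ⟨.comp b (.pair i (.comp c a)), fun p q hq n => ?_⟩
  have h3 := Part.eq_some_iff.2 (hq (n - 1))
  cases n <;> simp_all [OracleCode.eval, cons]

/-- Run one of two programs, depending on whether the entry `k` of the oracle is `0`; the other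
program need not be defined. -/
theorem exists_code_cond (k : ℕ) (c d : OracleCode) : ∃ e, ∀ p q,
    (p k = 0 → Computes c p q) → (p k ≠ 0 → Computes d p q) → Computes e p q := by
  obtain ⟨z, hz⟩ := exists_code_of_computable (Computable.const 0)
  obtain ⟨ck, hk⟩ := exists_code_of_computable (Computable.const k)
  obtain ⟨i, hi⟩ := exists_code_of_computable Computable.id
  obtain ⟨s, hs⟩ := exists_code_of_computable
    (f := fun n => if n = 0 then 1 else 0)
    (Primrec.ite (Primrec.eq.comp .id (.const 0)) (.const 1) (.const 0)).to_comp
  obtain ⟨t, ht⟩ := exists_code_of_computable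
    (f := fun n => if n = 0 then 0 else 1)
    (Primrec.ite (Primrec.eq.comp .id (.const 0)) (.const 0) (.const 1)).to_comp
  obtain ⟨a, ha⟩ := exists_code_of_computable (f := fun n => n.unpair.1 + n.unpair.2)
    (Primrec.nat_add.comp (Primrec.fst.comp .unpair) (Primrec.snd.comp .unpair)).to_comp
  refine ⟨.comp a (.pair
    (.comp (.prec z (.comp c .left)) (.pair i (.comp s (.comp .oracle ck))))
    (.comp (.prec z (.comp d .left)) (.pair i (.comp t (.comp .oracle ck))))), ?_⟩
  intro p q hc hd n
  by_cases h : p k = 0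
  · have h1 := Part.eq_some_iff.2 (hc h n)
    simp [OracleCode.eval, hz, hk, hi, hs, ht, ha, h, h1]
  · have h1 := Part.eq_some_iff.2 (hd h n)
    simp [OracleCode.eval, hz, hk, hi, hs, ht, ha, h, h1]

/-! ## Weihrauch reducibility is a preorder with suprema and infima -/

namespace Problem

theorem reducible_iff {P Q : Problem} : P.Reducible Q ↔
    ∃ h k : OracleCode, ∀ x ∈ P.dom, ∃ u ∈ Q.dom, Computes k x u ∧
      ∀ v ∈ Q.val u, ∃ w ∈ P.val x, Computes h (pair x v) w := by
  classical
  constructor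
  · rintro ⟨H, K, ⟨h, hH⟩, ⟨k, hK⟩, hg⟩
    refine ⟨h, k, fun x hx => ?_⟩
    let g₀ : Baire →. Baire := fun u => ⟨u ∈ Q.dom, fun hu => hu.some⟩
    have hg₀ : Q.IsChoice g₀ := fun u hu => ⟨hu.some, ⟨hu, rfl⟩, hu.some_mem⟩
    obtain ⟨w, hw, -⟩ := hg g₀ hg₀ x hx
    obtain ⟨u, hu, hw⟩ := Part.mem_bind_iff.1 hw
    obtain ⟨v, ⟨huQ, -⟩, -⟩ := Part.mem_bind_iff.1 hw
    refine ⟨u, huQ, hK x u hu, fun v hv => ?_⟩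
    let g : Baire →. Baire := fun u' => if u' = u then Part.some v else g₀ u'
    have hgQ : Q.IsChoice g := by
      intro u' hu'
      by_cases h : u' = u
      · subst h; exact ⟨v, by simp [g], hv⟩
      · obtain ⟨y, hy, hyQ⟩ := hg₀ u' hu'
        exact ⟨y, by simpa [g, h] using hy, hyQ⟩
    obtain ⟨w, hw, hwP⟩ := hg g hgQ x hx
    obtain ⟨u', hu', hw⟩ := Part.mem_bind_iff.1 hw
    obtain rfl := Part.mem_unique hu hu'
    obtain ⟨v', hv', hw'⟩ := Part.mem_bind_iff.1 hw
    obtain rfl : v' = v := by simpa [g] using hv'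
    exact ⟨w, hwP, hH _ _ hw'⟩
  · rintro ⟨h, k, hhk⟩
    let F : OracleCode → Baire →. Baire := fun c p => ⟨∃ q, Computes c p q, fun hq => hq.choose⟩
    have hF : ∀ c p q, q ∈ F c p ↔ Computes c p q := fun c p q =>
      ⟨fun ⟨hq, e⟩ => e ▸ hq.choose_spec,
        fun hq => ⟨⟨q, hq⟩, (Exists.choose_spec (⟨q, hq⟩ : ∃ q, Computes c p q)).unique hq⟩⟩
    refine ⟨F h, F k, ⟨h, fun p q hq => (hF _ _ _).1 hq⟩, ⟨k, fun p q hq => (hF _ _ _).1 hq⟩, ?_⟩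
    intro g hg x hx
    obtain ⟨u, huQ, hu, hv⟩ := hhk x hx
    obtain ⟨v, hvg, hvQ⟩ := hg u huQ
    obtain ⟨w, hwP, hw⟩ := hv v hvQ
    exact ⟨w, Part.mem_bind_iff.2 ⟨u, (hF _ _ _).2 hu,
      Part.mem_bind_iff.2 ⟨v, hvg, (hF _ _ _).2 hw⟩⟩, hwP⟩

theorem Reducible.refl (P : Problem) : P.Reducible P := by
  obtain ⟨r, hr⟩ := exists_code_right
  refine reducible_iff.2 ⟨r, .oracle, fun x hx => ⟨x, hx, computes_oracle x, fun v hv => ?_⟩⟩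
  exact ⟨v, hv, by simpa using hr (pair x v)⟩

theorem Reducible.trans {P Q R : Problem} (h₁ : P.Reducible Q) (h₂ : Q.Reducible R) :
    P.Reducible R := by
  obtain ⟨h, k, hhk⟩ := reducible_iff.1 h₁
  obtain ⟨h', k', hhk'⟩ := reducible_iff.1 h₂
  obtain ⟨l, hl⟩ := exists_code_left
  obtain ⟨r, hr⟩ := exists_code_right
  obtain ⟨e, he⟩ := exists_code_pair (.subst l k) r
  obtain ⟨e', he'⟩ := exists_code_pair l (.subst e h')
  refine reducible_iff.2 ⟨.subst e' h, .subst k k', fun x hx => ?_⟩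
  obtain ⟨u, hu, hku, hv⟩ := hhk x hx
  obtain ⟨u', hu', hku', hv'⟩ := hhk' u hu
  refine ⟨u', hu', hku.trans hku', fun w hw => ?_⟩
  obtain ⟨v, hvQ, hvc⟩ := hv' w hw
  obtain ⟨y, hyP, hyc⟩ := hv v hvQ
  have h1 : Computes l (pair x w) x := by simpa using hl (pair x w)
  have h2 : Computes r (pair x w) w := by simpa using hr (pair x w)
  exact ⟨y, hyP, (he' _ _ _ h1 ((he _ _ _ (h1.trans hku) h2).trans hvc)).trans hyc⟩

/-- Problems are preordered by Weihrauch reducibility. -/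
instance : Preorder Problem where
  le := Reducible
  le_refl := Reducible.refl
  le_trans _ _ _ := Reducible.trans

theorem le_def {P Q : Problem} : P ≤ Q ↔ P.Reducible Q := Iff.rfl

theorem empty_le (P : Problem) : empty ≤ P :=
  reducible_iff.2 ⟨.zero, .zero, fun _ hx => absurd hx Set.not_nonempty_empty⟩

theorem le_coprod_left (P Q : Problem) : P ≤ coprod P Q := by
  obtain ⟨k, hk⟩ := exists_code_cons 0 .oracle
  obtain ⟨r, hr⟩ := exists_code_right
  obtain ⟨s, hs⟩ := exists_code_shift
  refine reducible_iff.2 ⟨.subst r s, k, fun x hx => ⟨cons 0 x, ?_, hk _ _ (computes_oracle x), ?_⟩⟩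
  · obtain ⟨y, hy⟩ := hx
    exact ⟨cons 0 y, Or.inl ⟨x, y, hy, rfl, rfl⟩⟩
  · rintro v (⟨p, y, hy, hx', rfl⟩ | ⟨p, y, hy, hx', rfl⟩)
    · obtain ⟨-, rfl⟩ := cons_inj hx'
      exact ⟨y, hy, (hr _).trans (by simpa using hs (cons 0 y))⟩
    · exact absurd (cons_inj hx').1 (by simp)

theorem le_coprod_right (P Q : Problem) : Q ≤ coprod P Q := by
  obtain ⟨k, hk⟩ := exists_code_cons 1 .oracle
  obtain ⟨r, hr⟩ := exists_code_right
  obtain ⟨s, hs⟩ := exists_code_shift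
  refine reducible_iff.2 ⟨.subst r s, k, fun x hx => ⟨cons 1 x, ?_, hk _ _ (computes_oracle x), ?_⟩⟩
  · obtain ⟨y, hy⟩ := hx
    exact ⟨cons 1 y, Or.inr ⟨x, y, hy, rfl, rfl⟩⟩
  · rintro v (⟨p, y, hy, hx', rfl⟩ | ⟨p, y, hy, hx', rfl⟩)
    · exact absurd (cons_inj hx').1 (by simp)
    · obtain ⟨-, rfl⟩ := cons_inj hx'
      exact ⟨y, hy, (hr _).trans (by simpa using hs (cons 1 y))⟩

theorem coprod_le {P Q R : Problem} (hP : P ≤ R) (hQ : Q ≤ R) : coprod P Q ≤ R := by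
  obtain ⟨h, k, hhk⟩ := reducible_iff.1 hP
  obtain ⟨h', k', hhk'⟩ := reducible_iff.1 hQ
  obtain ⟨l, hl⟩ := exists_code_left
  obtain ⟨r, hr⟩ := exists_code_right
  obtain ⟨s, hs⟩ := exists_code_shift
  obtain ⟨K, hK⟩ := exists_code_cond 0 (.subst s k) (.subst s k')
  obtain ⟨e, he⟩ := exists_code_pair (.subst l s) r
  obtain ⟨c, hc⟩ := exists_code_cons 0 (.subst e h)
  obtain ⟨c', hc'⟩ := exists_code_cons 1 (.subst e h')
  obtain ⟨H, hH⟩ := exists_code_cond 0 c c'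
  have hpair : ∀ i p v, Computes e (pair (cons i p) v) (pair p v) := fun i p v => by
    have h1 : Computes l (pair (cons i p) v) (cons i p) := by simpa using hl (pair (cons i p) v)
    have h2 : Computes r (pair (cons i p) v) v := by simpa using hr (pair (cons i p) v)
    exact he _ _ _ (h1.trans (by simpa using hs (cons i p))) h2
  have hz : ∀ i p v, pair (cons i p) v 0 = i := fun i p v => rfl
  refine reducible_iff.2 ⟨H, K, ?_⟩
  rintro x ⟨y, ⟨p, t, ht, rfl, rfl⟩ | ⟨p, t, ht, rfl, rfl⟩⟩
  · obtain ⟨u, hu, hku, hv⟩ := hhk p ⟨t, ht⟩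
    refine ⟨u, hu, hK _ _ (fun _ => (hs _).trans (by simpa using hku)) (by simp), fun v hvR => ?_⟩
    obtain ⟨w, hw, hwc⟩ := hv v hvR
    exact ⟨cons 0 w, Or.inl ⟨p, w, hw, rfl, rfl⟩,
      hH _ _ (fun _ => hc _ _ ((hpair _ _ _).trans hwc)) (by simp [hz])⟩
  · obtain ⟨u, hu, hku, hv⟩ := hhk' p ⟨t, ht⟩
    refine ⟨u, hu, hK _ _ (by simp) (fun _ => (hs _).trans (by simpa using hku)), fun v hvR => ?_⟩
    obtain ⟨w, hw, hwc⟩ := hv v hvR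
    exact ⟨cons 1 w, Or.inr ⟨p, w, hw, rfl, rfl⟩,
      hH _ _ (by simp [hz]) (fun _ => hc' _ _ ((hpair _ _ _).trans hwc))⟩

theorem oplus_le_left (P Q : Problem) : oplus P Q ≤ P := by
  obtain ⟨l, hl⟩ := exists_code_left
  obtain ⟨r, hr⟩ := exists_code_right
  obtain ⟨c, hc⟩ := exists_code_cons 0 r
  refine reducible_iff.2 ⟨c, l, ?_⟩
  rintro x ⟨y, p, hp, q, hq, rfl, -⟩
  refine ⟨p, hp, by simpa using hl (pair p q), fun v hv => ?_⟩
  exact ⟨cons 0 v, ⟨p, hp, q, hq, rfl, Or.inl ⟨v, hv, rfl⟩⟩, hc _ _ (by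
    simpa using hr (pair (pair p q) v))⟩

theorem oplus_le_right (P Q : Problem) : oplus P Q ≤ Q := by
  obtain ⟨r, hr⟩ := exists_code_right
  obtain ⟨c, hc⟩ := exists_code_cons 1 r
  refine reducible_iff.2 ⟨c, r, ?_⟩
  rintro x ⟨y, p, hp, q, hq, rfl, -⟩
  refine ⟨q, hq, by simpa using hr (pair p q), fun v hv => ?_⟩
  exact ⟨cons 1 v, ⟨p, hp, q, hq, rfl, Or.inr ⟨v, hv, rfl⟩⟩, hc _ _ (by
    simpa using hr (pair (pair p q) v))⟩

theorem le_oplus {P Q R : Problem} (hP : R ≤ P) (hQ : R ≤ Q) : R ≤ oplus P Q := by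
  obtain ⟨h, k, hhk⟩ := reducible_iff.1 hP
  obtain ⟨h', k', hhk'⟩ := reducible_iff.1 hQ
  obtain ⟨l, hl⟩ := exists_code_left
  obtain ⟨r, hr⟩ := exists_code_right
  obtain ⟨s, hs⟩ := exists_code_shift
  obtain ⟨K, hK⟩ := exists_code_pair k k'
  obtain ⟨e, he⟩ := exists_code_pair l (.subst r s)
  obtain ⟨H, hH⟩ := exists_code_cond 1 (.subst e h) (.subst e h')
  have hpair : ∀ x i v, Computes e (pair x (cons i v)) (pair x v) := fun x i v => by
    have h1 : Computes l (pair x (cons i v)) x := by simpa using hl (pair x (cons i v))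
    have h2 : Computes r (pair x (cons i v)) (cons i v) := by simpa using hr (pair x (cons i v))
    exact he _ _ _ h1 (h2.trans (by simpa using hs (cons i v)))
  have hz : ∀ x i v, pair x (cons i v) 1 = i := fun x i v => rfl
  refine reducible_iff.2 ⟨H, K, fun x hx => ?_⟩
  obtain ⟨u, hu, hku, hv⟩ := hhk x hx
  obtain ⟨u', hu', hku', hv'⟩ := hhk' x hx
  refine ⟨pair u u', ?_, hK _ _ _ hku hku', ?_⟩
  · obtain ⟨y, hy⟩ := id hu
    exact ⟨cons 0 y, u, hu, u', hu', rfl, Or.inl ⟨y, hy, rfl⟩⟩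
  · rintro v ⟨p, -, q, -, hpq, ⟨y, hy, rfl⟩ | ⟨y, hy, rfl⟩⟩
    · obtain ⟨rfl, rfl⟩ := pair_inj hpq
      obtain ⟨w, hw, hwc⟩ := hv y hy
      exact ⟨w, hw, hH _ _ (fun _ => (hpair _ _ _).trans hwc) (by simp [hz])⟩
    · obtain ⟨rfl, rfl⟩ := pair_inj hpq
      obtain ⟨w, hw, hwc⟩ := hv' y hy
      exact ⟨w, hw, hH _ _ (by simp [hz]) (fun _ => (hpair _ _ _).trans hwc)⟩

end Problem

/-! ## The lattices -/

/-- The Weihrauch degrees of multi-valued functions on Baire space (without the artificial top):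
equivalence classes with respect to mutual Weihrauch reducibility, ordered by reducibility. -/
abbrev ProperDegree : Type := Antisymmetrization Problem (· ≤ ·)

/-- The degree of a multi-valued function. -/
def Problem.degree (P : Problem) : ProperDegree := toAntisymmetrization (· ≤ ·) P

theorem Problem.degree_le_degree {P Q : Problem} : P.degree ≤ Q.degree ↔ P.Reducible Q := Iff.rfl

/-- The lattice of Weihrauch degrees: the supremum is induced by `∐`, the infimum by `⊕`. -/
instance : Lattice ProperDegree where
  sup := Quotient.map₂ Problem.coprod fun _ _ h _ _ h' =>
    ⟨Problem.coprod_le (h.1.trans (Problem.le_coprod_left _ _))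
        (h'.1.trans (Problem.le_coprod_right _ _)),
      Problem.coprod_le (h.2.trans (Problem.le_coprod_left _ _))
        (h'.2.trans (Problem.le_coprod_right _ _))⟩
  inf := Quotient.map₂ Problem.oplus fun _ _ h _ _ h' =>
    ⟨Problem.le_oplus ((Problem.oplus_le_left _ _).trans h.1)
        ((Problem.oplus_le_right _ _).trans h'.1),
      Problem.le_oplus ((Problem.oplus_le_left _ _).trans h.2)
        ((Problem.oplus_le_right _ _).trans h'.2)⟩
  le_sup_left := by rintro ⟨P⟩ ⟨Q⟩; exact Problem.le_coprod_left P Q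
  le_sup_right := by rintro ⟨P⟩ ⟨Q⟩; exact Problem.le_coprod_right P Q
  sup_le := by rintro ⟨P⟩ ⟨Q⟩ ⟨R⟩ h h'; exact Problem.coprod_le h h'
  inf_le_left := by rintro ⟨P⟩ ⟨Q⟩; exact Problem.oplus_le_left P Q
  inf_le_right := by rintro ⟨P⟩ ⟨Q⟩; exact Problem.oplus_le_right P Q
  le_inf := by rintro ⟨P⟩ ⟨Q⟩ ⟨R⟩ h h'; exact Problem.le_oplus h h'

theorem Problem.degree_sup (P Q : Problem) : P.degree ⊔ Q.degree = (P.coprod Q).degree := rfl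

theorem Problem.degree_inf (P Q : Problem) : P.degree ⊓ Q.degree = (P.oplus Q).degree := rfl

/-- The bottom element is the degree of the multi-valued function with empty domain. -/
instance : OrderBot ProperDegree where
  bot := Problem.empty.degree
  bot_le := by rintro ⟨P⟩; exact Problem.empty_le P

/-- The Weihrauch lattice `𝔚`: the degrees of multi-valued functions together with an artificial
top element `⊤`, so that `a ⊔ ⊤ = ⊤` and `a ⊓ ⊤ = a`. -/
abbrev Degree : Type := WithTop ProperDegree

/-- The lattice `p𝔚` of pointed Weihrauch degrees: the upper cone of the degree of the identity
on Baire space, with the order and the operations of `𝔚`. -/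
abbrev PointedDegree : Type :=
  Set.Ici (WithTop.some Problem.ident.degree : Degree)

/-! ## Brouwer algebras -/

/-- A bounded lattice is a Brouwer algebra if for all elements `a`, `b` the set of all `c` with
`b ≤ c ⊔ a` has a smallest element. -/
def IsBrouwerAlgebra (L : Type*) [Lattice L] [BoundedOrder L] : Prop :=
  ∀ a b : L, ∃ c₀, IsLeast {c : L | b ≤ c ⊔ a} c₀

end Weihrauch

/-! Take pairwise Turing incomparable points p_0, p_1, … (`exists_pairwise_not_turingLE`) and a
surjection f on ℕ. Let b be the problem "given n, find p_n" and a the same problem for the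
rearranged sequence p ∘ f, both joined with the identity to make them pointed.

For every n, the tail d_n = "given i > n, find p_i", joined with the identity, satisfies b ≤ d_n ∨
a: the finitely many missing indices only need a finite table of f-preimages
(`family_univ_le_coprod`). A smallest c with b ≤ c ∨ a would lie below all d_n. Such a c cannot help
with any single p_n, which is computable neither outright nor from a p_m with m > n. Hence a
reduction of b to c ∨ a must, on input n, query p ∘ f at some m with f m = n, so one program finds
f-preimages (`exists_code_rightInverse`). Programs are countable while the involutions `swapPairs S`
are not, so some f defeats all programs (`exists_surjective_not_le`).

Since c may be any degree and the d_n are pointed, the same a and b refute both lattices. -/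

namespace Weihrauch

open Filter Topology

/-! ## Oracle programs: countability and the use principle -/

/-- An injective translation of oracle programs into Mathlib's codes of partial recursive
functions; it serves only to count programs. -/
def OracleCode.toCode : OracleCode → Nat.Partrec.Code
  | .zero => .zero
  | .succ => .succ
  | .left => .left
  | .right => .right
  | .oracle => .rfind' .zero
  | .pair f g => .pair (toCode f) (toCode g)
  | .comp f g => .comp (toCode f) (toCode g)
  | .prec f g => .prec (toCode f) (toCode g)
  -- Doubling `rfind'` keeps these images apart from the image `.rfind' .zero` of `oracle`.
  | .rfind f => .rfind' (.rfind' (toCode f))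

theorem OracleCode.toCode_injective : Function.Injective OracleCode.toCode := by
  intro c
  induction c with
  | zero | succ | left | right | oracle => intro d h; cases d <;> simp_all [toCode]
  | pair f g ihf ihg | comp f g ihf ihg | prec f g ihf ihg =>
    intro d h
    cases d <;> simp [toCode] at h
    rw [ihf h.1, ihg h.2]
  | rfind f ih =>
    intro d h
    cases d <;> simp [toCode] at h
    rw [ih h]

instance : Countable OracleCode := OracleCode.toCode_injective.countable

/-- The use principle: a terminating oracle computation reads only a finite part of the oracle. -/
theorem OracleCode.eventually_mem_eval {p : Baire} (c : OracleCode) {n a : ℕ}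
    (h : a ∈ c.eval p n) : ∀ᶠ q in 𝓝 p, a ∈ c.eval q n := by
  induction c generalizing n a with
  | zero | succ | left | right => exact Eventually.of_forall fun _ => h
  | oracle =>
    obtain rfl : a = p n := by simpa [eval] using h
    have hc : Tendsto (fun q : Baire => q n) (𝓝 p) (𝓝 (p n)) := (continuous_apply n).tendsto p
    rw [nhds_discrete ℕ, tendsto_pure] at hc
    filter_upwards [hc] with q hq
    simp [eval, hq]
  | pair f g ihf ihg =>
    simp only [eval, Part.mem_bind_iff, Part.mem_map_iff] at h ⊢
    obtain ⟨x, hx, y, hy, rfl⟩ := h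
    filter_upwards [ihf hx, ihg hy] with q hq hq'
    exact ⟨x, hq, y, hq', rfl⟩
  | comp f g ihf ihg =>
    simp only [eval, Part.mem_bind_iff] at h ⊢
    obtain ⟨x, hx, hy⟩ := h
    filter_upwards [ihg hx, ihf hy] with q hq hq'
    exact ⟨x, hq, hq'⟩
  | prec f g ihf ihg =>
    simp only [eval] at h ⊢
    generalize n.unpair.2 = k at h ⊢
    induction k generalizing a with
    | zero => exact ihf h
    | succ k ih =>
      obtain ⟨x, hx, hy⟩ := Part.mem_bind_iff.1 h
      filter_upwards [ih hx, ihg hy] with q hq hq'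
      exact Part.mem_bind_iff.2 ⟨x, hq, hq'⟩
  | rfind f ih =>
    obtain ⟨h0, hlt⟩ := Nat.mem_rfind.1 h
    obtain ⟨x, hx, hx0⟩ := (Part.mem_map_iff _).1 h0
    -- The search makes only finitely many failing tests before it stops at `a`, so their
    -- neighbourhoods can be intersected.
    have key : ∀ᶠ q in 𝓝 p, ∀ m ∈ Set.Iio a,
        ∃ y ∈ f.eval q (Nat.pair n m), decide (y = 0) = false := by
      refine ((Set.finite_Iio a).eventually_all).2 fun m hm => ?_
      obtain ⟨y, hy, hy0⟩ := (Part.mem_map_iff _).1 (hlt hm)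
      filter_upwards [ih hy] with q hq
      exact ⟨y, hq, hy0⟩
    filter_upwards [ih hx, key] with q hq hq'
    exact Nat.mem_rfind.2 ⟨(Part.mem_map_iff _).2 ⟨x, hq, hx0⟩,
      fun {m} hm => (Part.mem_map_iff _).2 (hq' m hm)⟩

/-! ## Turing reducibility -/

/-- `q` is computable from `p`. -/
def TuringLE (q p : Baire) : Prop := ∃ c : OracleCode, Computes c p q

theorem TuringLE.refl (p : Baire) : TuringLE p p := ⟨_, computes_oracle p⟩

theorem TuringLE.trans {p q r : Baire} (h : TuringLE p q) (h' : TuringLE q r) : TuringLE p r := by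
  obtain ⟨c, hc⟩ := h
  obtain ⟨d, hd⟩ := h'
  exact ⟨_, hd.trans hc⟩

theorem TuringLE.cons {p q : Baire} (k : ℕ) (h : TuringLE p q) : TuringLE (cons k p) q := by
  obtain ⟨c, hc⟩ := h
  obtain ⟨e, he⟩ := exists_code_cons k c
  exact ⟨e, he _ _ hc⟩

theorem TuringLE.pair {p q r : Baire} (h : TuringLE p r) (h' : TuringLE q r) :
    TuringLE (pair p q) r := by
  obtain ⟨c, hc⟩ := h
  obtain ⟨d, hd⟩ := h'
  obtain ⟨e, he⟩ := exists_code_pair c d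
  exact ⟨e, he _ _ _ hc hd⟩

theorem turingLE_zero (p : Baire) : TuringLE 0 p := ⟨.zero, fun _ => Part.mem_some _⟩

/-- In the space of all sequences of points of Baire space, for `m ≠ n` generically the entry `n`
is not computed from the entry `m` by a given program. -/
theorem eventually_residual_not_computes (c : OracleCode) {m n : ℕ} (hmn : m ≠ n) :
    ∀ᶠ P : ℕ → Baire in residual (ℕ → Baire), ¬ Computes c (P m) (P n) := by
  -- `F` says that the program gives a wrong answer somewhere; by the use principle this is an open
  -- condition.
  let F : Set (ℕ → Baire) := {P | ∃ k, ∃ a ∈ c.eval (P m) k, P n k ≠ a}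
  have hF : IsOpen F := by
    refine isOpen_iff_mem_nhds.2 ?_
    rintro P ⟨k, a, ha, hne⟩
    have h1 : ∀ᶠ Q : ℕ → Baire in 𝓝 P, a ∈ c.eval (Q m) k :=
      (continuous_apply m).tendsto P (c.eventually_mem_eval ha)
    have h2 : Tendsto (fun Q : ℕ → Baire => Q n k) (𝓝 P) (𝓝 (P n k)) :=
      ((continuous_apply k).comp (continuous_apply n)).tendsto P
    rw [nhds_discrete ℕ, tendsto_pure] at h2
    filter_upwards [h1, h2] with Q hQ hQ'
    exact ⟨k, a, hQ, hQ' ▸ hne⟩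
  have hU : F ∪ interior Fᶜ ∈ residual (ℕ → Baire) := by
    refine residual_of_dense_open (hF.union isOpen_interior) ?_
    rw [interior_compl]
    intro P
    by_cases hP : P ∈ closure F
    · exact closure_mono Set.subset_union_left hP
    · exact subset_closure (Or.inr hP)
  filter_upwards [hU] with P hP hc
  rcases hP with ⟨k, a, ha, hne⟩ | hP
  · exact hne (Part.mem_unique (hc k) ha)
  -- Changing entry `k` of `P n` leaves the oracle `P m` alone, so the program's answer becomes
  -- wrong and `Q k` lies in `F`. But `Q k` tends to `P`, which is interior to the complement of
  -- `F`.
  · let Q : ℕ → ℕ → Baire := fun k =>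
      Function.update P n (Function.update (P n) k (P n k + 1))
    have hQ : Tendsto Q atTop (𝓝 P) := by
      refine tendsto_pi_nhds.2 fun i => ?_
      by_cases hi : i = n
      · subst hi
        refine tendsto_pi_nhds.2 fun j => tendsto_const_nhds.congr' ?_
        filter_upwards [eventually_gt_atTop j] with k hk
        simp [Q, Function.update_of_ne hk.ne]
      · simp [Q, Function.update_of_ne hi]
    obtain ⟨k, hk⟩ := (hQ.eventually (mem_interior_iff_mem_nhds.1 hP)).exists
    refine hk ⟨k, P n k, ?_, ?_⟩
    · simpa [Q, Function.update_of_ne hmn] using hc k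
    · simp [Q]

/-- There is a sequence of pairwise Turing incomparable points of Baire space. -/
theorem exists_pairwise_not_turingLE :
    ∃ p : ℕ → Baire, ∀ m n, TuringLE (p n) (p m) → m = n := by
  -- There are countably many conditions, one for each `m`, `n` and program, so the Baire category
  -- theorem applies.
  have h : ∀ᶠ P : ℕ → Baire in residual (ℕ → Baire), ∀ m n (c : OracleCode),
      m ≠ n → ¬ Computes c (P m) (P n) := by
    simp only [eventually_countable_forall]
    exact fun m n c hmn => eventually_residual_not_computes c hmn
  obtain ⟨P, hP⟩ := (dense_of_mem_residual h).nonempty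
  exact ⟨P, fun m n ⟨c, hc⟩ => by_contra fun hmn => hP m n c hmn hc⟩

/-! ## Families of constant problems -/

namespace Problem

/-- The problem with instances `n 0 0 0 …` for `n ∈ s`, whose only solution is `p n`. -/
def family (s : Set ℕ) (p : ℕ → Baire) : Problem :=
  ⟨fun x => {y | ∃ n ∈ s, x = cons n 0 ∧ y = p n}⟩

/-- The index is the first entry of the instance, so a uniformly computable sequence of queries `G`
suffices. The `shift` removes the tag that answers of a coproduct carry. -/
theorem family_le_of_computable {s : Set ℕ} {p : ℕ → Baire} {R : Problem} {G : ℕ → Baire}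
    (hG : Computable fun n : ℕ => G n.unpair.1 n.unpair.2)
    (hR : ∀ i ∈ s, G i ∈ R.dom ∧ ∀ v ∈ R.val (G i), shift v = p i) : family s p ≤ R := by
  obtain ⟨g, hg⟩ := exists_code_of_computable hG
  obtain ⟨i, hi⟩ := exists_code_of_computable Computable.id
  obtain ⟨r, hr⟩ := exists_code_right
  obtain ⟨t, ht⟩ := exists_code_shift
  refine reducible_iff.2 ⟨.subst r t, .comp g (.pair (.comp .oracle .zero) i), ?_⟩
  rintro x ⟨y, n, hn, rfl, rfl⟩
  refine ⟨G n, (hR n hn).1, fun k => by simp [OracleCode.eval, hg, hi], fun v hv => ?_⟩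
  refine ⟨p n, ⟨n, hn, rfl, rfl⟩, (hr _).trans ?_⟩
  rw [right_pair, ← (hR n hn).2 v hv]
  exact ht v

theorem computable_cons_cons {f g : ℕ → ℕ} (hf : Computable f) (hg : Computable g) :
    Computable fun n : ℕ => cons (f n.unpair.1) (cons (g n.unpair.1) 0) n.unpair.2 := by
  have h1 : Computable fun n : ℕ => n.unpair.1 := Computable.fst.comp Computable.unpair
  have h2 : Computable fun n : ℕ => n.unpair.2 := Computable.snd.comp Computable.unpair
  have h3 : Computable fun n : ℕ => n.unpair.2 - 1 := Computable.pred.comp h2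
  have key : Computable fun n : ℕ => bif n.unpair.2 == 0 then f n.unpair.1 else
      bif n.unpair.2 - 1 == 0 then g n.unpair.1 else 0 :=
    Computable.cond (Primrec.beq.to_comp.comp h2 (.const 0)) (hf.comp h1)
      (Computable.cond (Primrec.beq.to_comp.comp h3 (.const 0)) (hg.comp h1) (.const 0))
  refine key.of_eq fun n => ?_
  rcases n.unpair.2 with _ | _ | k <;> simp [cons]

/-- Finitely many members of a family can be answered with the help of a family that contains them
in some other order. -/
theorem family_univ_le_coprod (p : ℕ → Baire) {f : ℕ → ℕ} (hf : Function.Surjective f) (N : ℕ) :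
    family Set.univ p ≤ coprod (family (Set.Ici N) p) (family Set.univ (p ∘ f)) := by
  obtain ⟨g, hg⟩ := hf.hasRightInverse
  have ht : Computable fun i : ℕ => if i < N then 1 else 0 :=
    (Primrec.ite (Primrec.nat_lt.comp .id (.const N)) (.const 1) (.const 0)).to_comp
  -- The right inverse `g` need not be computable, but its first `N` values form a finite table. The
  -- default `0` is never used.
  have hj : Computable fun i : ℕ => if i < N then ((List.range N).map g).getD i 0 else i :=
    (Primrec.ite (Primrec.nat_lt.comp .id (.const N))
      ((Primrec.list_getD 0).comp (.const ((List.range N).map g)) .id) .id).to_comp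
  refine family_le_of_computable (G := fun i => cons (if i < N then 1 else 0)
    (cons (if i < N then ((List.range N).map g).getD i 0 else i) 0))
    (computable_cons_cons ht hj) fun i _ => ?_
  by_cases hi : i < N
  · have hgi : ((List.range N).map g).getD i 0 = g i := by simp [List.getD, hi]
    simp only [hi, if_true, hgi]
    constructor
    · exact ⟨cons 1 (p i), Or.inr ⟨_, p i, ⟨g i, trivial, rfl, by simp [hg i]⟩, rfl, rfl⟩⟩
    · rintro v (⟨x, r, -, hx, -⟩ | ⟨x, r, ⟨n, -, rfl, rfl⟩, hx, rfl⟩)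
      · exact absurd (cons_inj hx).1 one_ne_zero
      · obtain rfl := (cons_inj (cons_inj hx).2).1
        simp [hg i]
  · simp only [hi, if_false]
    constructor
    · exact ⟨cons 0 (p i), Or.inl ⟨_, p i, ⟨i, not_lt.1 hi, rfl, rfl⟩, rfl, rfl⟩⟩
    · rintro v (⟨x, r, ⟨n, -, rfl, rfl⟩, hx, rfl⟩ | ⟨x, r, -, hx, -⟩)
      · obtain rfl := (cons_inj (cons_inj hx).2).1
        rfl
      · exact absurd (cons_inj hx).1 zero_ne_one

/-! ### Turing reductions extracted from Weihrauch reductions -/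

/-- The only instance is computable, hence so is the query made on it. The answer is then a tagged
`p m`, or, from `ident`, the computable query itself. -/
theorem turingLE_of_family_singleton_le {p : ℕ → Baire} {t : Set ℕ} {n : ℕ}
    (h : family {n} p ≤ coprod (family t p) ident) :
    (∃ m ∈ t, TuringLE (p n) (p m)) ∨ TuringLE (p n) 0 := by
  obtain ⟨H, K, hHK⟩ := reducible_iff.1 h
  obtain ⟨u, ⟨v, hv⟩, hK, hH⟩ := hHK (cons n 0) ⟨p n, n, rfl, rfl, rfl⟩
  obtain ⟨w, ⟨m, rfl, -, rfl⟩, hw⟩ := hH v hv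
  have hle : ∀ r, TuringLE v r → TuringLE (p m) r := fun r hr =>
    TuringLE.trans ⟨H, hw⟩ (((turingLE_zero r).cons m).pair hr)
  rcases hv with ⟨x, r, ⟨i, hi, rfl, rfl⟩, rfl, rfl⟩ | ⟨x, r, hr, rfl, rfl⟩
  · exact Or.inl ⟨i, hi, hle _ ((TuringLE.refl _).cons 0)⟩
  · obtain rfl : r = x := hr
    exact Or.inr (hle _ (TuringLE.trans ⟨K, hK⟩ ((TuringLE.refl 0).cons m)))

/-- This covers a reduction to a coproduct that sends the instance `n` to the summand `C`: dropping
the tag from the query and restoring it on the answer leaves a reduction to `C` alone. -/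
theorem family_singleton_le {C : Problem} {p : ℕ → Baire} {n : ℕ} {H K : OracleCode} {v : Baire}
    (hv : v ∈ C.dom) (hK : Computes K (cons n 0) (cons 0 v))
    (hH : ∀ w ∈ C.val v, Computes H (pair (cons n 0) (cons 0 w)) (p n)) : family {n} p ≤ C := by
  obtain ⟨l, hl⟩ := exists_code_left
  obtain ⟨r, hr⟩ := exists_code_right
  obtain ⟨s, hs⟩ := exists_code_shift
  obtain ⟨d, hd⟩ := exists_code_cons 0 r
  obtain ⟨e, he⟩ := exists_code_pair l d
  refine reducible_iff.2 ⟨.subst e H, .subst K s, ?_⟩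
  rintro x ⟨y, m, rfl, rfl, rfl⟩
  refine ⟨v, hv, hK.trans (hs _), fun w hw => ⟨p m, ⟨m, rfl, rfl, rfl⟩, ?_⟩⟩
  refine Computes.trans (he _ (cons m 0) (cons 0 w) ?_ (hd _ _ ?_)) (hH w hw)
  · simpa using hl (pair (cons m 0) w)
  · simpa using hr (pair (cons m 0) w)

/-- If a family of pairwise Turing incomparable points is reduced to its rearrangement `p ∘ f`
together with some `C` that is of no use for any single member, then one program finds the
positions of the points in the rearrangement. -/
theorem exists_code_rightInverse {p : ℕ → Baire} (hp : ∀ m n, TuringLE (p n) (p m) → m = n)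
    {f : ℕ → ℕ} {C : Problem} (hC : ∀ n, C ≤ coprod (family (Set.Ioi n) p) ident)
    (h : family Set.univ p ≤ coprod C (coprod (family Set.univ (p ∘ f)) ident)) :
    ∃ K : OracleCode, ∀ n, ∃ m, f m = n ∧
      Computes K (cons n 0) (cons 1 (cons 0 (cons m 0))) := by
  have hp0 : ∀ n, ¬ TuringLE (p n) 0 := fun n hn =>
    (Nat.succ_ne_self n) (hp _ n (hn.trans (turingLE_zero (p (n + 1)))))
  obtain ⟨H, K, hHK⟩ := reducible_iff.1 h
  refine ⟨K, fun n => ?_⟩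
  obtain ⟨u, ⟨v, hv⟩, hK, hH⟩ := hHK (cons n 0) ⟨p n, n, trivial, rfl, rfl⟩
  have hH' : ∀ v ∈ (coprod C (coprod (family Set.univ (p ∘ f)) ident)).val u,
      Computes H (pair (cons n 0) v) (p n) := by
    intro v hv
    obtain ⟨w, ⟨m, -, hm, rfl⟩, hw⟩ := hH v hv
    obtain rfl := (cons_inj hm).1
    exact hw
  have hle : ∀ r, TuringLE v r → TuringLE (p n) r := fun r hr =>
    TuringLE.trans ⟨H, hH' v hv⟩ (((turingLE_zero r).cons n).pair hr)
  -- A query to `C` would make `C` useful for `p n`, and an answer from `ident` would make `p n`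
  -- computable. Only a query to `p ∘ f` at some `m` remains; then `p n` is computable from `p (f
  -- m)`, and incomparability gives `f m = n`.
  rcases hv with ⟨x, r, hr, rfl, rfl⟩ |
    ⟨x, r, ⟨y, z, ⟨m, -, rfl, rfl⟩, rfl, rfl⟩ | ⟨y, z, hz, rfl, rfl⟩, rfl, rfl⟩
  · have hs : family {n} p ≤ C := family_singleton_le ⟨r, hr⟩ hK fun w hw =>
      hH' _ (Or.inl ⟨x, w, hw, rfl, rfl⟩)
    rcases turingLE_of_family_singleton_le (hs.trans (hC n)) with ⟨m, hm, hmn⟩ | h0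
    · exact absurd (hp m n hmn) hm.ne'
    · exact absurd h0 (hp0 n)
  · exact ⟨m, hp _ _ (hle _ (((TuringLE.refl _).cons 0).cons 1)), hK⟩
  · obtain rfl : z = y := hz
    exact absurd (hle _ (TuringLE.trans ⟨K, hK⟩ ((TuringLE.refl 0).cons n))) (hp0 n)

/-! ### Rearrangements that no program can invert -/

/-- Exchange `2 * i` and `2 * i + 1` for all `i ∈ S`. -/
noncomputable def swapPairs (S : Set ℕ) (n : ℕ) : ℕ :=
  open Classical in if n / 2 ∈ S then (if n % 2 = 0 then n + 1 else n - 1) else n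

theorem swapPairs_involutive (S : Set ℕ) : Function.Involutive (swapPairs S) := by
  intro n
  by_cases h : n / 2 ∈ S
  · rcases Nat.mod_two_eq_zero_or_one n with h2 | h2
    · have h3 : (n + 1) / 2 = n / 2 := by omega
      have h4 : (n + 1) % 2 = 1 := by omega
      simp [swapPairs, h, h2, h3, h4]
    · have h3 : (n - 1) / 2 = n / 2 := by omega
      have h4 : (n - 1) % 2 = 0 := by omega
      have h5 : n - 1 + 1 = n := by omega
      simp [swapPairs, h, h2, h3, h4, h5]
  · simp [swapPairs, h]

theorem swapPairs_injective : Function.Injective swapPairs := by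
  intro S T h
  ext i
  have hi := congrFun h (2 * i)
  by_cases hS : i ∈ S <;> by_cases hT : i ∈ T <;> simp_all [swapPairs]

/-- A counting argument: if every `swapPairs S` failed, each with its own `C`, each would yield a
program computing its inverse, which is `swapPairs S` itself. The program determines `S`, so the
power set of ℕ would inject into ℕ. -/
theorem exists_surjective_not_le {p : ℕ → Baire} (hp : ∀ m n, TuringLE (p n) (p m) → m = n) :
    ∃ f : ℕ → ℕ, Function.Surjective f ∧ ∀ C : Problem,
      (∀ n, C ≤ coprod (family (Set.Ioi n) p) ident) →
        ¬ family Set.univ p ≤ coprod C (coprod (family Set.univ (p ∘ f)) ident) := by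
  by_contra! hcon
  have key : ∀ S : Set ℕ, ∃ K : OracleCode, ∀ n,
      Computes K (cons n 0) (cons 1 (cons 0 (cons (swapPairs S n) 0))) := by
    intro S
    obtain ⟨C, hC, h⟩ := hcon _ (swapPairs_involutive S).surjective
    obtain ⟨K, hK⟩ := exists_code_rightInverse hp hC h
    refine ⟨K, fun n => ?_⟩
    obtain ⟨m, rfl, hm⟩ := hK n
    rwa [swapPairs_involutive S m]
  choose K hK using key
  have hinj : Function.Injective K := fun S T hST => swapPairs_injective <| funext fun n => by
    have h := (hK S n).unique (hST ▸ hK T n)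
    -- Entries 0 and 1 are the coproduct tags; entry 2 is the queried index.
    exact congrFun h 2
  obtain ⟨g, hg⟩ := exists_injective_nat OracleCode
  exact Function.cantor_injective _ (hg.comp hinj)

end Problem

/-! ### Passage to degrees -/

/-- Two pointed degrees without a smallest relative complement. -/
theorem exists_degrees_no_least : ∃ a b : ProperDegree,
    Problem.ident.degree ≤ a ∧ Problem.ident.degree ≤ b ∧
      ∀ c : Degree, (b : Degree) ≤ c ⊔ a →
        ∃ d : ProperDegree, Problem.ident.degree ≤ d ∧ b ≤ d ⊔ a ∧ ¬ c ≤ d := by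
  obtain ⟨p, hp⟩ := exists_pairwise_not_turingLE
  obtain ⟨f, hf, hfC⟩ := Problem.exists_surjective_not_le hp
  refine ⟨(Problem.family Set.univ (p ∘ f)).degree ⊔ Problem.ident.degree,
    (Problem.family Set.univ p).degree ⊔ Problem.ident.degree, le_sup_right, le_sup_right, ?_⟩
  intro c hc
  induction c using WithTop.recTopCoe with
  -- Here `d` is `b` itself, a proper degree and so not above `⊤`.
  | top => exact ⟨_, le_sup_right, le_sup_left, WithTop.not_top_le_coe _⟩
  | coe c =>
    obtain ⟨C, rfl⟩ : ∃ C : Problem, C.degree = c := Quotient.exists_rep c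
    rw [← WithTop.coe_sup, WithTop.coe_le_coe] at hc
    by_contra! hcon
    refine hfC C (fun n => ?_) (le_sup_left.trans hc)
    -- The assumed minimality of `c` is tested against the tail of indices above `n`, joined with
    -- the identity.
    suffices hd : (Problem.family Set.univ p).degree ⊔ Problem.ident.degree ≤
        ((Problem.family (Set.Ioi n) p).degree ⊔ Problem.ident.degree) ⊔
          ((Problem.family Set.univ (p ∘ f)).degree ⊔ Problem.ident.degree) by
      have hle := WithTop.coe_le_coe.1 (hcon _ le_sup_right hd)
      exact hle
    have h : (Problem.family Set.univ p).degree ≤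
        (Problem.family (Set.Ici (n + 1)) p).degree ⊔ (Problem.family Set.univ (p ∘ f)).degree :=
      Problem.family_univ_le_coprod p hf (n + 1)
    rw [← Set.Ici_succ_eq_Ioi]
    exact sup_le (h.trans (sup_le_sup le_sup_left le_sup_left)) (le_sup_right.trans le_sup_right)

end Weihrauch

theorem theorem20 :
    ¬ Weihrauch.IsBrouwerAlgebra Weihrauch.Degree ∧
      ¬ Weihrauch.IsBrouwerAlgebra Weihrauch.PointedDegree := by
  obtain ⟨a, b, ha, hb, h⟩ := Weihrauch.exists_degrees_no_least
  constructor
  · intro hB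
    obtain ⟨c, hc, hle⟩ := hB a b
    obtain ⟨d, -, hd, hcd⟩ := h c hc
    exact hcd (hle (show (b : Weihrauch.Degree) ≤ d ⊔ a from WithTop.coe_le_coe.2 hd))
  · intro hB
    obtain ⟨c, hc, hle⟩ := hB ⟨a, WithTop.coe_le_coe.2 ha⟩ ⟨b, WithTop.coe_le_coe.2 hb⟩
    obtain ⟨d, hid, hd, hcd⟩ := h c.1 hc
    exact hcd (hle (a := ⟨d, WithTop.coe_le_coe.2 hid⟩)
      (show (b : Weihrauch.Degree) ≤ d ⊔ a from WithTop.coe_le_coe.2 hd))
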